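/- Let $G$ be a connected, locally path connected topological group (no separation axiom is assumed). Definitions. A continuous map $p:(\widetilde X,\tilde x_0)\to (X,x_0)$ has the unique lifting property if for every connected, locally path connected pointed space $(Y,y_0)$ and every continuous map $f:(Y,y_0)\to (X,x_0)$ with $f_*\pi_1(Y,y_0)\subseteq p_*\pi_1(\widetilde X,\tilde x_0)$ there is exactly one continuous map $\tilde f:(Y,y_0)\to(\widetilde X,\tilde x_0)$ with $p\circ\tilde f=f$. If $\widetilde G$ is a topological group with identity $\tilde e$ and $p:\widetilde G\to G$ is a continuous homomorphism, then $(\widetilde G,p)$ is a generalized covering group of $G$ if $\widetilde G$ is connected and locally path connected and $p:(\widetilde G,\tilde e)\to(G,e)$ has the unique lifting property. A continuous map $p:E\to X$ is a rigid covering fibration if it is a (Hurewicz) fibration, i.e. has the homotopy lifting property with respect to all topological spaces, and has unique path lifting, i.e. any two paths $\alpha,\beta:[0,1]\to E$ with $\alpha(0)=\beta(0)$ and $p\circ\alpha=p\circ\beta$ are equal. Then the following hold. (i) For every topological group $\widetilde G$ and every continuous homomorphism $p:\widetilde G\to G$, the pair $(\widetilde G,p)$ is a generalized covering group of $G$ if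 and only if $\widetilde G$ is connected and locally path connected and $p$ is a rigid covering fibration. (ii) For every topological space $\widetilde G$ and every continuous map $p:\widetilde G\to G$, there is a group structure on $\widetilde G$ that makes $\widetilde G$ a topological group, $p$ a homomorphism and $(\widetilde G,p)$ a generalized covering group of $G$, if and only if $\widetilde G$ is connected and locally path connected and $p$ is a rigid covering fibration. -/

import Mathlib

open scoped unitInterval

universe u

namespace GenCov

/-- The unique lifting property of `p : (E, e₀) → (X, p e₀)`: for every connected, locally path
connected pointed space `(Y, y₀)`, every continuous `f : (Y, y₀) → (X, p e₀)` with
`f_* π₁(Y, y₀) ⊆ p_* π₁(E, e₀)` has exactly one continuous lift `(Y, y₀) → (E, e₀)`. -/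
def HasUniqueLiftingProperty {E X : Type u} [TopologicalSpace E] [TopologicalSpace X]
    (p : C(E, X)) (e₀ : E) : Prop :=
  ∀ (Y : Type u) [TopologicalSpace Y] [ConnectedSpace Y] [LocallyPathConnectedSpace Y]
    (y₀ : Y) (f : C(Y, X)) (hf : f y₀ = p e₀),
    (FundamentalGroup.mapOfEq f hf).range ≤ (FundamentalGroup.map p e₀).range →
      ∃! g : C(Y, E), g y₀ = e₀ ∧ p.comp g = f

/-- `p : (E, e₀) → (X, p e₀)` is a generalized covering map: `E` is connected and locally path
connected, and `p` has the unique lifting property. -/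
structure IsGeneralizedCovering {E X : Type u} [TopologicalSpace E] [TopologicalSpace X]
    (p : C(E, X)) (e₀ : E) : Prop where
  connected : ConnectedSpace E
  locPathConnected : LocallyPathConnectedSpace E
  uniqueLifting : HasUniqueLiftingProperty p e₀

/-- For topological groups `E`, `G` and a continuous homomorphism `p : E → G`, the pair `(E, p)` is
a generalized covering group of `G` if `p : (E, 1) → (G, 1)` is a generalized covering map. -/
def IsGeneralizedCoveringGroup {E G : Type u} [Group E] [TopologicalSpace E]
    [IsTopologicalGroup E] [Group G] [TopologicalSpace G] [IsTopologicalGroup G]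
    (p : E →ₜ* G) : Prop :=
  IsGeneralizedCovering (p : C(E, G)) 1

/-- A (Hurewicz) fibration: the homotopy lifting property with respect to every space. -/
def IsFibration {E X : Type u} [TopologicalSpace E] [TopologicalSpace X] (p : C(E, X)) : Prop :=
  ∀ (Y : Type u) [TopologicalSpace Y] (f : C(Y, E)) (F : C(I × Y, X)),
    (∀ y, F (0, y) = p (f y)) →
      ∃ L : C(I × Y, E), (∀ y, L (0, y) = f y) ∧ p.comp L = F

/-- Unique path lifting: two paths in `E` with the same initial point and the same projection
to `X` are equal. -/
def HasUniquePathLifting {E X : Type u} [TopologicalSpace E] [TopologicalSpace X]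
    (p : C(E, X)) : Prop :=
  ∀ a b : C(I, E), a 0 = b 0 → p.comp a = p.comp b → a = b

/-- A rigid covering fibration: a fibration with unique path lifting. -/
structure IsRigidCoveringFibration {E X : Type u} [TopologicalSpace E] [TopologicalSpace X]
    (p : C(E, X)) : Prop where
  fibration : IsFibration p
  uniquePathLifting : HasUniquePathLifting p

end GenCov

/-! A rigid covering fibration satisfies the lifting criterion (`exists_lift`): lift along paths;
the lifted endpoint varies continuously because all paths issuing from a point are lifted at once,
as a single homotopy over a path space. Conversely, the space of paths in `G` based at 1 is
contractible and locally path connected, so the unique lifting property lifts endpoint evaluation to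
a map `Φ` into `E`. Translating by group elements turns `Φ` into a lift of arbitrary homotopies
(`HasUniqueLiftingProperty.isFibration`). For (ii), multiplication and inversion of `G` lift to `E`
by the criterion, and the group axioms follow from uniqueness of lifts. -/

namespace GenCov

open Filter Topology

/-! ### Lifting paths and loops -/

section PathLifting

variable {E X : Type u} [TopologicalSpace E] [TopologicalSpace X] {p : C(E, X)}

theorem IsFibration.exists_path_lift (hp : IsFibration p) {x x' : X} (γ : Path x x') {e : E}
    (he : p e = x) : ∃ (e' : E) (c : Path e e'), ∀ t, p (c t) = γ t := by
  obtain ⟨L, hL, hpL⟩ := hp PUnit (ContinuousMap.const _ e) (γ.toContinuousMap.comp .fst)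
    (by simp [he])
  refine ⟨L (1, ⟨⟩), ⟨⟨fun t => L (t, ⟨⟩), by fun_prop⟩, hL _, rfl⟩, fun t => ?_⟩
  exact DFunLike.congr_fun hpL (t, PUnit.unit)

theorem IsFibration.exists_square_lift (hp : IsFibration p) (f : C(I, E)) (F : C(I × I, X))
    (h : ∀ t, F (0, t) = p (f t)) :
    ∃ L : C(I × I, E), (∀ t, L (0, t) = f t) ∧ ∀ z, p (L z) = F z := by
  obtain ⟨L, hL, hpL⟩ := hp (ULift.{u} I) (f.comp ⟨ULift.down, by fun_prop⟩)
    (F.comp ⟨fun z => (z.1, z.2.down), by fun_prop⟩) (fun t => h _)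
  refine ⟨L.comp ⟨fun z => (z.1, ULift.up z.2), by fun_prop⟩, fun t => hL _, fun z => ?_⟩
  exact DFunLike.congr_fun hpL (z.1, ULift.up z.2)

theorem HasUniquePathLifting.endpoint_eq (hp : HasUniquePathLifting p) {e e₁ e₂ : E}
    (c : Path e e₁) (d : Path e e₂) (h : ∀ t, p (c t) = p (d t)) : e₁ = e₂ := by
  have := hp c.toContinuousMap d.toContinuousMap (by simp) (ContinuousMap.ext h)
  simpa using DFunLike.congr_fun this 1

theorem HasUniquePathLifting.endpoint_eq_of_const (hp : HasUniquePathLifting p) {e e' : E}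
    (c : Path e e') (h : ∀ t, p (c t) = p e) : e' = e :=
  hp.endpoint_eq c (Path.refl e) (by simpa using h)

theorem HasUniquePathLifting.lift_unique (hp : HasUniquePathLifting p) {Y : Type*}
    [TopologicalSpace Y] [PathConnectedSpace Y] {g g' : C(Y, E)} (y₀ : Y) (h₀ : g y₀ = g' y₀)
    (h : ∀ y, p (g y) = p (g' y)) : g = g' := by
  ext y
  let γ := PathConnectedSpace.somePath y₀ y
  exact hp.endpoint_eq (γ.map g.continuous) ((γ.map g'.continuous).cast h₀ rfl)
    (fun t => h (γ t))

/-- Lift the homotopy starting from `c`. Its side edges lie over constant paths, hence are constant,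
so the far edge is again a loop at `e₀`. -/
theorem IsRigidCoveringFibration.loop_of_homotopic (hp : IsRigidCoveringFibration p) {e₀ : E}
    (c : Path e₀ e₀) (γ : Path (p e₀) (p e₀)) (h : (c.map p.continuous).Homotopic γ) :
    ∃ d : Path e₀ e₀, ∀ t, p (d t) = γ t := by
  obtain ⟨H⟩ := h
  obtain ⟨L, hL, hpL⟩ := hp.fibration.exists_square_lift c.toContinuousMap
    H.toHomotopy.toContinuousMap (fun t => H.apply_zero t)
  have h0 : L (1, 0) = e₀ := by
    refine hp.uniquePathLifting.endpoint_eq_of_const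
      ⟨⟨fun t => L (t, 0), by fun_prop⟩, by simp [hL], rfl⟩ (fun t => ?_)
    exact (hpL _).trans (H.source t)
  have h1 : L (1, 1) = e₀ := by
    refine hp.uniquePathLifting.endpoint_eq_of_const
      ⟨⟨fun t => L (t, 1), by fun_prop⟩, by simp [hL], rfl⟩ (fun t => ?_)
    exact (hpL _).trans (H.target t)
  refine ⟨⟨⟨fun t => L (1, t), by fun_prop⟩, h0, h1⟩, fun t => ?_⟩
  exact (hpL _).trans (H.apply_one t)

end PathLifting

/-- The map `t ↦ t / 2` of the unit interval to itself. -/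
noncomputable def halfMap : C(I, I) :=
  ⟨fun t => ⟨t / 2, by linarith [t.2.1], by linarith [t.2.2]⟩, by fun_prop⟩

theorem trans_halfMap {X : Type*} [TopologicalSpace X] {x y z : X} (γ : Path x y) (δ : Path y z)
    (t : I) : γ.trans δ (halfMap t) = γ t := by
  have h : ((halfMap t : I) : ℝ) = t / 2 := rfl
  rw [Path.trans_apply, dif_pos (by rw [h]; linarith [t.2.2])]
  congr 1
  ext
  simp [h]
  ring

/-- A subbasic condition `C → U` satisfied by the constant map is either vacuous or says `y ∈ U`. -/
theorem exists_nhds_of_mem_nhds_const {K Y : Type*} [TopologicalSpace K] [TopologicalSpace Y]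
    {y : Y} {W : Set C(K, Y)} (hW : W ∈ 𝓝 (ContinuousMap.const K y)) :
    ∃ U ∈ 𝓝 y, ∀ δ : C(K, Y), (∀ t, δ t ∈ U) → δ ∈ W := by
  have mono : Monotone fun U : Set Y => {δ : C(K, Y) | ∀ t, δ t ∈ U} :=
    fun U V h δ hδ t => h (hδ t)
  have key : Tendsto id ((𝓝 y).lift' fun U => {δ : C(K, Y) | ∀ t, δ t ∈ U})
      (𝓝 (ContinuousMap.const K y)) := by
    rw [ContinuousMap.tendsto_nhds_compactOpen]
    intro C _ U hU h
    rw [eventually_lift'_iff mono]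
    obtain rfl | ⟨k, hk⟩ := C.eq_empty_or_nonempty
    · exact ⟨Set.univ, univ_mem, fun δ _ => Set.mapsTo_empty _ _⟩
    · exact ⟨U, hU.mem_nhds (h hk), fun δ hδ t _ => hδ t⟩
  obtain ⟨U, hU, h⟩ := (mem_lift'_sets mono).1 (key hW)
  exact ⟨U, hU, fun δ hδ => h hδ⟩

/-! ### The lifting criterion -/

section Lifting

variable {E X : Type u} [TopologicalSpace E] [TopologicalSpace X] {p : C(E, X)}

/-- The lifting criterion for fibrations with unique path lifting. -/
theorem IsRigidCoveringFibration.exists_lift (hp : IsRigidCoveringFibration p) {Y : Type u}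
    [TopologicalSpace Y] [PathConnectedSpace Y] [LocallyPathConnectedSpace Y] (f : C(Y, X))
    (y₀ : Y) (e₀ : E) (h : ∀ γ : Path y₀ y₀, ∃ c : Path e₀ e₀, ∀ t, p (c t) = f (γ t)) :
    ∃ g : C(Y, E), g y₀ = e₀ ∧ p.comp g = f := by
  have h₀ : p e₀ = f y₀ := by
    obtain ⟨c, hc⟩ := h (Path.refl y₀)
    simpa using hc 0
  have ex (y : Y) : ∃ (e : E) (γ : Path y₀ y) (c : Path e₀ e), ∀ t, p (c t) = f (γ t) := by
    obtain ⟨e, c, hc⟩ := hp.fibration.exists_path_lift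
      ((PathConnectedSpace.somePath y₀ y).map f.continuous) h₀
    exact ⟨e, _, c, hc⟩
  choose g γ c hc using ex
  have indep {y : Y} {e : E} (δ : Path y₀ y) (d : Path e₀ e) (hd : ∀ t, p (d t) = f (δ t)) :
      g y = e := by
    -- The two halves of `l`, run forwards and backwards from `e₀`, lift the images of `γ y` and
    -- `δ`, and they meet at the midpoint of `l`.
    obtain ⟨l, hl⟩ := h ((γ y).trans δ.symm)
    have h1 : g y = l (halfMap 1) := by
      refine hp.uniquePathLifting.endpoint_eq (c y)
        ⟨l.toContinuousMap.comp halfMap, ?_, rfl⟩ (fun t => ?_)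
      · have : halfMap 0 = 0 := by ext; simp [halfMap]
        simp [this]
      · exact (hc y t).trans (((hl _).trans (congrArg f (trans_halfMap _ _ t))).symm)
    have h2 : e = l.symm (halfMap 1) := by
      refine hp.uniquePathLifting.endpoint_eq d
        ⟨l.symm.toContinuousMap.comp halfMap, ?_, rfl⟩ (fun t => ?_)
      · have : halfMap 0 = 0 := by ext; simp [halfMap]
        simp [this]
      · have : ((γ y).trans δ.symm) (unitInterval.symm (halfMap t)) = δ t := by
          change ((γ y).trans δ.symm).symm (halfMap t) = δ t
          rw [Path.trans_symm, Path.symm_symm, trans_halfMap]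
        exact (hd t).trans ((hl _).trans (congrArg f this)).symm
    rw [h1, h2, Path.symm_apply]
    congr 1
    ext
    simp [halfMap]
    norm_num
  have hpg (y : Y) : p (g y) = f y := by simpa using hc y 1
  have hg : Continuous g := by
    refine continuous_iff_continuousAt.2 fun y O hO => ?_
    -- The parameter space consists of all paths from `y`, so `L (1, δ)` depends continuously on
    -- `δ`; paths inside a small neighbourhood of `y` are close to the constant path.
    obtain ⟨L, hL, hpL⟩ := hp.fibration {δ : C(I, Y) // δ 0 = y} (.const _ (g y))
      ⟨fun z => f (z.2.1 z.1), by fun_prop⟩ (fun δ => by simp [δ.2, hpg])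
    replace hpL (z : I × {δ : C(I, Y) // δ 0 = y}) : p (L z) = f (z.2.1 z.1) := DFunLike.congr_fun hpL z
    have lift_path (δ : {δ : C(I, Y) // δ 0 = y}) : g (δ.1 1) = L (1, δ) := by
      let δ' : Path y (δ.1 1) := ⟨δ.1, δ.2, rfl⟩
      let d : Path (g y) (L (1, δ)) := ⟨⟨fun t => L (t, δ), by fun_prop⟩, hL δ, rfl⟩
      refine indep ((γ y).trans δ') ((c y).trans d) (fun t => ?_)
      simp only [Path.trans_apply]
      split_ifs
      · exact hc _ _
      · exact hpL _
    let k : {δ : C(I, Y) // δ 0 = y} := ⟨ContinuousMap.const I y, rfl⟩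
    have hk : L (1, k) = g y := (lift_path k).symm
    have hN : (fun δ : {δ : C(I, Y) // δ 0 = y} => L (1, δ)) ⁻¹' O ∈ 𝓝 k := by
      have : Continuous fun δ : {δ : C(I, Y) // δ 0 = y} => L (1, δ) := by fun_prop
      exact this.continuousAt.preimage_mem_nhds (by rwa [hk])
    obtain ⟨W, hW, hWN⟩ := mem_nhds_subtype _ _ _ |>.1 hN
    obtain ⟨U, hU, hUW⟩ := exists_nhds_of_mem_nhds_const hW
    refine mem_map.2 (mem_of_superset (pathComponentIn_mem_nhds hU) fun y' hy' => ?_)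
    obtain ⟨δ, hδ⟩ := hy'
    have : g y' = L (1, ⟨δ.toContinuousMap, δ.source⟩) := by
      rw [← lift_path]
      exact congrArg g δ.target.symm
    rw [Set.mem_preimage, this]
    exact hWN (hUW _ hδ)
  exact ⟨⟨g, hg⟩, indep (Path.refl y₀) (Path.refl e₀) (by simpa using h₀), ContinuousMap.ext hpg⟩

theorem IsRigidCoveringFibration.hasUniqueLiftingProperty (hp : IsRigidCoveringFibration p)
    (e₀ : E) : HasUniqueLiftingProperty p e₀ := by
  intro Y _ _ _ y₀ f hf hle
  have : PathConnectedSpace Y := .of_locallyPathConnectedSpace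
  obtain ⟨g, hg₀, hg⟩ := hp.exists_lift f y₀ e₀ (fun γ => by
    obtain ⟨a, ha⟩ := hle ⟨FundamentalGroup.fromPath ⟦γ⟧, rfl⟩
    obtain ⟨c, rfl⟩ := Path.Homotopic.Quotient.mk_surjective a
    have hc := hp.loop_of_homotopic c ((γ.map f.continuous).cast hf.symm hf.symm)
    rw [FundamentalGroup.mapOfEq_apply] at ha
    exact hc (Path.Homotopic.Quotient.exact ha))
  refine ⟨g, ⟨hg₀, hg⟩, fun g' ⟨hg'₀, hg'⟩ => ?_⟩
  exact hp.uniquePathLifting.lift_unique y₀ (hg'₀.trans hg₀.symm)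
    (fun y => DFunLike.congr_fun (hg'.trans hg.symm) y)

theorem HasUniqueLiftingProperty.existsUnique_lift {e₀ : E} (hp : HasUniqueLiftingProperty p e₀)
    {Y : Type u} [TopologicalSpace Y] [ContractibleSpace Y] [LocallyPathConnectedSpace Y]
    (y₀ : Y) (f : C(Y, X)) (hf : f y₀ = p e₀) :
    ∃! g : C(Y, E), g y₀ = e₀ ∧ p.comp g = f := by
  refine hp Y y₀ f hf ?_
  rintro _ ⟨a, rfl⟩
  rw [Subsingleton.elim a 1, map_one]
  exact one_mem _

end Lifting

/-! ### The group of based paths -/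

section PathGroup

variable (G : Type u) [Group G] [TopologicalSpace G] [IsTopologicalGroup G]

/-- The group of paths in `G` starting at the identity. -/
abbrev BasedPath : Type u := {δ : C(I, G) // δ 0 = 1}

variable {G}

/-- The path `s ↦ δ (s t)`, as a based path depending on `t` and `δ`. -/
def BasedPath.shrink (t : I) (δ : BasedPath G) : BasedPath G :=
  ⟨δ.1.comp ⟨fun s => s * t, by fun_prop⟩, by simp [δ.2]⟩

theorem BasedPath.continuous_shrink :
    Continuous fun z : I × BasedPath G => BasedPath.shrink z.1 z.2 := by
  refine Continuous.subtype_mk (ContinuousMap.continuous_of_continuous_uncurry _ ?_) _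
  change Continuous fun z : (I × BasedPath G) × I => z.1.2.1 (z.2 * z.1.1)
  fun_prop

instance : ContractibleSpace (BasedPath G) := by
  rw [contractible_iff_id_nullhomotopic]
  refine ⟨⟨1, rfl⟩, ⟨ContinuousMap.Homotopy.symm ⟨⟨_, BasedPath.continuous_shrink⟩, ?_, ?_⟩⟩⟩
  · intro δ
    ext s
    simp [BasedPath.shrink, δ.2]
  · intro δ
    ext s
    simp [BasedPath.shrink]

/-- If `ε` is near `δ`, then `η = δ⁻¹ε` has values near 1, and so do all its shrinkings; `δ * shrink
t η` joins `δ` to `ε` without leaving the neighbourhood. -/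
instance : LocallyPathConnectedSpace (BasedPath G) := by
  rw [locallyPathConnectedSpace_iff_pathComponentIn_mem_nhds]
  intro δ W hWo hδW
  obtain ⟨W', hW', hW'W⟩ := mem_nhds_subtype _ _ _ |>.1 (hWo.mem_nhds hδW)
  have h1 : (fun η : C(I, G) => δ.1 * η) ⁻¹' W' ∈ 𝓝 (ContinuousMap.const I (1 : G)) := by
    refine (continuous_const_mul δ.1).continuousAt.preimage_mem_nhds ?_
    have : δ.1 * ContinuousMap.const I (1 : G) = δ.1 := mul_one _
    rwa [this]
  obtain ⟨U, hU, hUW⟩ := exists_nhds_of_mem_nhds_const h1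
  obtain ⟨V, hVU, hV, h1V⟩ := mem_nhds_iff.1 hU
  have hN : {ε : BasedPath G | Set.MapsTo (δ.1⁻¹ * ε.1) Set.univ V} ∈ 𝓝 δ := by
    have : Continuous fun ε : BasedPath G => δ.1⁻¹ * ε.1 := by fun_prop
    refine this.continuousAt.preimage_mem_nhds
      ((ContinuousMap.isOpen_setOfPred_mapsTo isCompact_univ hV).mem_nhds ?_)
    intro t _
    simpa using h1V
  refine mem_of_superset hN fun ε hε => ?_
  let η : BasedPath G := ⟨δ.1⁻¹ * ε.1, by simp [δ.2, ε.2]⟩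
  let Φ : I → BasedPath G := fun t => ⟨δ.1 * (BasedPath.shrink t η).1, by
    simp [δ.2, (BasedPath.shrink t η).2]⟩
  have hΦ : Continuous Φ := by
    have : Continuous fun t => BasedPath.shrink t η :=
      BasedPath.continuous_shrink.comp (by fun_prop : Continuous fun t : I => (t, η))
    exact Continuous.subtype_mk (continuous_const.mul (continuous_subtype_val.comp this)) _
  refine ⟨⟨⟨Φ, hΦ⟩, ?_, ?_⟩, fun t => hW'W (hUW _ fun s => hVU (hε (Set.mem_univ _)))⟩
  · ext s
    simp [Φ, η, BasedPath.shrink, δ.2, ε.2]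
  · ext s
    simp [Φ, η, BasedPath.shrink]

end PathGroup

instance : ContractibleSpace I :=
  (convex_Icc (0 : ℝ) 1).contractibleSpace ⟨0, by simp⟩

instance : LocallyPathConnectedSpace I :=
  (convex_Icc (0 : ℝ) 1).locallyPathConnectedSpace

/-! ### Homomorphisms and lifted group structures -/

section Groups

variable {E G : Type u} [TopologicalSpace E] [Group G] [TopologicalSpace G]

theorem HasUniqueLiftingProperty.hasUniquePathLifting [Group E] [IsTopologicalGroup E]
    {p : E →ₜ* G} (hp : HasUniqueLiftingProperty (p : C(E, G)) 1) :
    HasUniquePathLifting (p : C(E, G)) := by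
  intro a b hab hpab
  have : ContractibleSpace (ULift.{u} I) := Homeomorph.ulift.contractibleSpace
  have : LocallyPathConnectedSpace (ULift.{u} I) :=
    Homeomorph.ulift.isOpenEmbedding.locallyPathConnectedSpace
  -- Translation moves the common initial point to 1, where uniqueness of lifts is available.
  let a' : C(ULift.{u} I, E) := ⟨fun t => (a 0)⁻¹ * a t.down, by fun_prop⟩
  let b' : C(ULift.{u} I, E) := ⟨fun t => (a 0)⁻¹ * b t.down, by fun_prop⟩
  have h0 : a' ⟨0⟩ = 1 := by simp [a']
  have hpab' : (p : C(E, G)).comp b' = (p : C(E, G)).comp a' := by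
    ext t
    have : p (a t.down) = p (b t.down) := DFunLike.congr_fun hpab t.down
    simp [a', b', this]
  have key : a' = b' := (hp.existsUnique_lift ⟨0⟩ ((p : C(E, G)).comp a') (by simp [h0])).unique
    ⟨h0, rfl⟩ ⟨by simp [b', hab], hpab'⟩
  ext t
  simpa [a', b'] using DFunLike.congr_fun key ⟨t⟩

variable [IsTopologicalGroup G]

theorem HasUniqueLiftingProperty.isFibration [Group E] [IsTopologicalGroup E]
    {p : E →ₜ* G} (hp : HasUniqueLiftingProperty (p : C(E, G)) 1) :
    IsFibration (p : C(E, G)) := by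
  obtain ⟨Φ, ⟨hΦ, hpΦ⟩, -⟩ := hp.existsUnique_lift (⟨1, rfl⟩ : BasedPath G)
    ⟨fun δ => δ.1 1, by fun_prop⟩ (by simp)
  replace hpΦ (δ : BasedPath G) : p (Φ δ) = δ.1 1 := DFunLike.congr_fun hpΦ δ
  intro Y _ f F hF
  -- The track of `F` over `y` up to time `z.1`, translated to start at 1; at time 0 it is the
  -- trivial path, so the lift starts at `f`.
  let Ψ (z : I × Y) : BasedPath G :=
    ⟨⟨fun s => (p (f z.2))⁻¹ * F (s * z.1, z.2), by fun_prop⟩, by simp [hF]⟩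
  have hΨ : Continuous Ψ := by
    refine Continuous.subtype_mk (ContinuousMap.continuous_of_continuous_uncurry _ ?_) _
    change Continuous fun w : (I × Y) × I => (p (f w.1.2))⁻¹ * F (w.2 * w.1.1, w.1.2)
    have := p.continuous_toFun
    fun_prop
  refine ⟨⟨fun z => f z.2 * Φ (Ψ z), by fun_prop⟩, fun y => ?_, ?_⟩
  · have : Ψ (0, y) = ⟨1, rfl⟩ := by
      ext s
      simp [Ψ, hF]
    simp [this, hΦ]
  · ext z
    simp [hpΦ, Ψ]

/-- A homomorphism of topological groups is a generalized covering group if and only if it is a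
rigid covering fibration with connected and locally path connected total space. -/
theorem isGeneralizedCoveringGroup_iff [Group E] [IsTopologicalGroup E] (p : E →ₜ* G) :
    IsGeneralizedCoveringGroup p ↔
      ConnectedSpace E ∧ LocallyPathConnectedSpace E ∧
        IsRigidCoveringFibration (p : C(E, G)) :=
  ⟨fun h => ⟨h.connected, h.locPathConnected,
    h.uniqueLifting.isFibration, h.uniqueLifting.hasUniquePathLifting⟩,
   fun ⟨h₁, h₂, h₃⟩ => ⟨h₁, h₂, h₃.hasUniqueLiftingProperty 1⟩⟩

theorem IsFibration.surjective {E X : Type u} [TopologicalSpace E] [TopologicalSpace X]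
    {p : C(E, X)} (hp : IsFibration p) [Nonempty E] [PathConnectedSpace X] :
    Function.Surjective p := by
  intro x
  obtain ⟨e⟩ := ‹Nonempty E›
  obtain ⟨e', c, hc⟩ := hp.exists_path_lift (PathConnectedSpace.somePath (p e) x) rfl
  exact ⟨e', by simpa using hc 1⟩

variable {p : C(E, G)}

theorem IsRigidCoveringFibration.exists_mul [PathConnectedSpace E] [LocallyPathConnectedSpace E]
    (hp : IsRigidCoveringFibration p) {e₀ : E} (he₀ : p e₀ = 1) :
    ∃ m : C(E × E, E), m (e₀, e₀) = e₀ ∧ ∀ x y, p (m (x, y)) = p x * p y := by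
  obtain ⟨m, hm₀, hm⟩ := hp.exists_lift (⟨fun z => p z.1 * p z.2, by fun_prop⟩ : C(E × E, G))
    (e₀, e₀) e₀ (fun γ => by
      let a : Path e₀ e₀ := γ.map continuous_fst
      let b : Path e₀ e₀ := γ.map continuous_snd
      -- The wanted loop is the diagonal of a lifted square. Two of its edges lift `p ∘ a` and then
      -- `p ∘ b`, so by uniqueness they end at `e₀`.
      obtain ⟨L, hL, hpL⟩ := hp.fibration.exists_square_lift b.toContinuousMap
        ⟨fun z => p (a z.1) * p (b z.2), by fun_prop⟩ (fun t => by simp [he₀])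
      have h10 : L (1, 0) = e₀ := by
        refine hp.uniquePathLifting.endpoint_eq
          ⟨⟨fun t => L (t, 0), by fun_prop⟩, by simp [hL], rfl⟩ a (fun t => ?_)
        simp [hpL, he₀]
      have h11 : L (1, 1) = e₀ := by
        refine hp.uniquePathLifting.endpoint_eq
          ⟨⟨fun t => L (1, t), by fun_prop⟩, h10, rfl⟩ b (fun t => ?_)
        simp [hpL, he₀]
      exact ⟨⟨⟨fun t => L (t, t), by fun_prop⟩, by simp [hL], h11⟩, fun t => hpL _⟩)
  exact ⟨m, hm₀, fun x y => DFunLike.congr_fun hm (x, y)⟩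

theorem IsRigidCoveringFibration.exists_inv [PathConnectedSpace E] [LocallyPathConnectedSpace E]
    (hp : IsRigidCoveringFibration p) {e₀ : E} (he₀ : p e₀ = 1) (m : C(E × E, E))
    (hm : ∀ x y, p (m (x, y)) = p x * p y) (hm₀ : ∀ x, m (e₀, x) = x) :
    ∃ i : C(E, E), i e₀ = e₀ ∧ ∀ x, p (i x) = (p x)⁻¹ := by
  obtain ⟨i, hi₀, hi⟩ := hp.exists_lift (⟨fun x => (p x)⁻¹, by fun_prop⟩ : C(E, G)) e₀ e₀
    (fun γ => by
      obtain ⟨e, c, hc⟩ := hp.fibration.exists_path_lift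
        (γ.map (by fun_prop : Continuous fun x => (p x)⁻¹)) (e := e₀) (by simp [he₀])
      have he : e = e₀ := by
        -- The product of `γ` and `c` lies over 1, hence is constant at `e₀`; its endpoint is `m
        -- (e₀, e) = e`.
        refine hp.uniquePathLifting.endpoint_eq_of_const
          ⟨⟨fun t => m (γ t, c t), by fun_prop⟩, by simp [hm₀], by simp [hm₀]⟩ (fun t => ?_)
        simp [hm, hc, he₀]
      subst he
      exact ⟨c, hc⟩)
  exact ⟨i, hi₀, fun x => DFunLike.congr_fun hi x⟩

/-- The total space of a rigid covering fibration over a topological group is a topological group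
and the projection is a homomorphism. -/
theorem IsRigidCoveringFibration.exists_group [PathConnectedSpace E] [LocallyPathConnectedSpace E]
    [PathConnectedSpace G] (hp : IsRigidCoveringFibration p) :
    ∃ (_ : Group E) (_ : IsTopologicalGroup E) (q : E →ₜ* G), (q : C(E, G)) = p := by
  obtain ⟨e₀, he₀⟩ := hp.fibration.surjective 1
  obtain ⟨m, hm₀, hm⟩ := hp.exists_mul he₀
  -- Each axiom compares two lifts of one map that agree at the base point.
  have one_mul (x : E) : m (e₀, x) = x :=
    DFunLike.congr_fun (hp.uniquePathLifting.lift_unique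
      (g := m.comp (.prodMk (.const E e₀) (.id E))) (g' := .id E) e₀ (by simp [hm₀]) (by simp [hm, he₀])) x
  obtain ⟨i, hi₀, hi⟩ := hp.exists_inv he₀ m hm one_mul
  have inv_mul (x : E) : m (i x, x) = e₀ :=
    DFunLike.congr_fun (hp.uniquePathLifting.lift_unique (g := m.comp (.prodMk i (.id E)))
      (g' := .const E e₀) e₀ (by simp [hm₀, hi₀]) (by simp [hm, hi, he₀])) x
  have assoc (x y z : E) : m (m (x, y), z) = m (x, m (y, z)) :=
    DFunLike.congr_fun (hp.uniquePathLifting.lift_unique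
      (g := (⟨fun w => m (m (w.1, w.2.1), w.2.2), by fun_prop⟩ : C(E × E × E, E)))
      (g' := ⟨fun w => m (w.1, m (w.2.1, w.2.2)), by fun_prop⟩)
      (e₀, e₀, e₀) (by simp [hm₀]) (by simp [hm, mul_assoc])) (x, y, z)
  let : Mul E := ⟨fun x y => m (x, y)⟩
  let : Inv E := ⟨i⟩
  let : One E := ⟨e₀⟩
  let : Group E := Group.ofLeftAxioms assoc one_mul inv_mul
  have : IsTopologicalGroup E :=
    { continuous_mul := m.continuous
      continuous_inv := i.continuous }
  exact ⟨inferInstance, this,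
    { toFun := p, map_one' := he₀, map_mul' := hm, continuous_toFun := p.continuous }, rfl⟩

end Groups

end GenCov

theorem mainTheorem8 {G : Type u} [Group G] [TopologicalSpace G] [IsTopologicalGroup G]
    [ConnectedSpace G] [LocallyPathConnectedSpace G] :
    (∀ (E : Type u) [Group E] [TopologicalSpace E] [IsTopologicalGroup E] (p : E →ₜ* G),
      GenCov.IsGeneralizedCoveringGroup p ↔
        ConnectedSpace E ∧ LocallyPathConnectedSpace E ∧
          GenCov.IsRigidCoveringFibration (p : C(E, G))) ∧
    (∀ (E : Type u) [TopologicalSpace E] (p : C(E, G)),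
      (∃ (_ : Group E) (_ : IsTopologicalGroup E) (q : E →ₜ* G),
          (q : C(E, G)) = p ∧ GenCov.IsGeneralizedCoveringGroup q) ↔
        ConnectedSpace E ∧ LocallyPathConnectedSpace E ∧
          GenCov.IsRigidCoveringFibration p) := by
  refine ⟨fun E _ _ _ p => GenCov.isGeneralizedCoveringGroup_iff p, fun E _ p => ⟨?_, ?_⟩⟩
  · rintro ⟨_, _, q, rfl, hq⟩
    exact (GenCov.isGeneralizedCoveringGroup_iff q).1 hq
  · rintro ⟨h₁, h₂, hp⟩
    have : PathConnectedSpace E := .of_locallyPathConnectedSpace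
    have : PathConnectedSpace G := .of_locallyPathConnectedSpace
    obtain ⟨hE, hE', q, rfl⟩ := hp.exists_group
    exact ⟨hE, hE', q, rfl, (GenCov.isGeneralizedCoveringGroup_iff q).2 ⟨h₁, h₂, hp⟩⟩
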